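/- Let $[n]=\{1,\dots,n\}$. For distributions $p,q$ on a finite set write $\|q\|_2=(\sum_x q(x)^2)^{1/2}$ and $\|p-q\|_1=\sum_x|p(x)-q(x)|$. Sources $p_1,\dots,p_s$ on $[n]$ satisfy the structural condition relative to $q$ if there is a set $A\subseteq[n]$ with $p_i(x)\ge q(x)$ for all $i$ and all $x\in A$, and $p_i(x)\le q(x)$ for all $i$ and all $x\notin A$. The Identity-Tester with constant $c_1$ gets a known distribution $q$ on a domain of size $n$ and $\varepsilon>0$. It puts $s=\lceil c_1 n\|q\|_2/\varepsilon^2\rceil$ and draws $\mathrm{Poi}(1)$ samples from each of $s$ unknown sources $p_1,\dots,p_s$, all numbers of samples and all samples being independent. With $T_x$ the number of occurrences of $x$ among all the samples, it computes $Z=\sum_x\big((T_x-s\,q(x))^2-T_x\big)$, rejects if $Z\ge 5s^2\varepsilon^2/(8n)$, and accepts otherwise. Flattening: for $q$ on $[n]$ let $b_x=\lfloor n q(x)\rfloor+1$ and $D=\{(x,y): x\in[n],\ y\in[b_x]\}$. A sample $x$ is flattened by drawing $y\in[b_x]$ uniformly and independently and replacing $x$ by $(x,y)\in D$; let $q'$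 on $D$ be the law of a flattened sample from $q$, that is, $q'(x,y)=q(x)/b_x$. The flattened Identity-Tester runs the Identity-Tester on the domain $D$ with known distribution $q'$ and with $s'=\lceil c_1|D|\,\|q'\|_2/\varepsilon^2\rceil$ sources $p_1,\dots,p_{s'}$ on $[n]$, flattening every sample it receives. **Theorem.** There is a constant $c_1>0$ such that the following holds for every $n$, every distribution $q$ on $[n]$ and every $\varepsilon>0$. 1. If $p_1=\dots=p_s=q$, then the Identity-Tester accepts with probability at least $2/3$. If $p_1,\dots,p_s$ satisfy the structural condition relative to $q$ and $\|p_i-q\|_1\ge\varepsilon$ for all $i$, then it rejects with probability at least $2/3$. 2. The two statements of part 1 also hold for the flattened Identity-Tester and sources $p_1,\dots,p_{s'}$ on $[n]$. Its total number of samples has law $\mathrm{Poi}(s')$, and for $\varepsilon\le2$ one has $s'\le C\sqrt n/\varepsilon^2$ with an absolute constant $C$; so it uses $O(\sqrt n/\varepsilon^2)$ sources and, in expectation, as many samples. -/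

import Mathlib

open scoped NNReal ENNReal

noncomputable section

namespace MultiSource

/-- The `ℓ₂`-norm of a distribution on a finite domain. -/
def l2Norm {α : Type} [Fintype α] (q : PMF α) : ℝ :=
  Real.sqrt (∑ x, (q x).toReal ^ 2)

/-- The `ℓ₁`-distance of two distributions on a finite domain. -/
def l1Dist {α : Type} [Fintype α] (p q : PMF α) : ℝ :=
  ∑ x, |(p x).toReal - (q x).toReal|

/-- The structural condition: there is a set `A` such that every source puts at least the mass of
`q` on each element of `A`, and at most the mass of `q` on each element outside `A`. -/
def Structural {α : Type} {s : ℕ} (p : Fin s → PMF α) (q : PMF α) : Prop :=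
  ∃ A : Set α, ∀ i, (∀ x ∈ A, q x ≤ p i x) ∧ (∀ x ∉ A, p i x ≤ q x)

/-- Independent draws, one from each distribution in a list. -/
def drawEach {β : Type} : List (PMF β) → PMF (List β)
  | [] => PMF.pure []
  | p :: ps => p.bind fun x => (drawEach ps).bind fun l => PMF.pure (x :: l)

/-- The Poisson distribution `Poi(r)`. -/
def poisson (r : ℝ≥0) : PMF ℕ := (ProbabilityTheory.poissonMeasure r).toPMF

/-- `Poi(1)` independent samples from `p`. -/
def poissonSamples {α : Type} (p : PMF α) : PMF (List α) :=
  (poisson 1).bind fun k => drawEach (List.replicate k p)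

/-- `Poi(1)` samples from each of the `s` sources, all independent; one list for each source. -/
def drawSamples {α : Type} {s : ℕ} (p : Fin s → PMF α) : PMF (List (List α)) :=
  drawEach (List.ofFn fun j => poissonSamples (p j))

/-- The total number of samples received. -/
def numSamples {α : Type} (S : List (List α)) : ℕ := S.flatten.length

/-- `T_x`, the number of times that `x` occurs among the samples. -/
def occurrences {α : Type} [DecidableEq α] (S : List (List α)) (x : α) : ℕ := S.flatten.count x

/-- The statistic `Z = ∑ₓ ((T_x - s q(x))² - T_x)`. -/
def statistic {α : Type} [Fintype α] [DecidableEq α] (s : ℕ) (q : PMF α)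
    (S : List (List α)) : ℝ :=
  ∑ x, (((occurrences S x : ℝ) - s * (q x).toReal) ^ 2 - occurrences S x)

/-- The threshold `τ = 5 s² ε² / (8 n)`. -/
def threshold (n s : ℕ) (ε : ℝ) : ℝ := 5 * (s : ℝ) ^ 2 * ε ^ 2 / (8 * n)

/-- The two possible outputs of a tester. -/
inductive Verdict
  | accept
  | reject

/-- The verdict on given samples: reject if and only if `Z ≥ τ`. -/
def verdict {α : Type} [Fintype α] [DecidableEq α] (s : ℕ) (q : PMF α) (ε : ℝ)
    (S : List (List α)) : Verdict :=
  open Classical in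
  if threshold (Fintype.card α) s ε ≤ statistic s q S then Verdict.reject else Verdict.accept

/-- The number of sources, `s = ⌈c₁ n ‖q‖₂ / ε²⌉`. -/
def numSources {α : Type} [Fintype α] (c₁ : ℝ) (q : PMF α) (ε : ℝ) : ℕ :=
  ⌈c₁ * Fintype.card α * l2Norm q / ε ^ 2⌉₊

/-- The law of the output of the identity tester. -/
def identityTester {α : Type} [Fintype α] [DecidableEq α] (c₁ : ℝ) (q : PMF α) (ε : ℝ)
    (p : Fin (numSources c₁ q ε) → PMF α) : PMF Verdict :=
  (drawSamples p).bind fun S => PMF.pure (verdict (numSources c₁ q ε) q ε S)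

/-- The number `b_x = ⌊n q(x)⌋ + 1` of buckets into which the flattening splits `x`. -/
abbrev buckets {α : Type} [Fintype α] (q : PMF α) (x : α) : ℕ :=
  ⌊(Fintype.card α : ℝ) * (q x).toReal⌋₊ + 1

/-- The flattened domain `{(x, y) : y ∈ [b_x]}`. -/
abbrev FlatDomain {α : Type} [Fintype α] (q : PMF α) : Type := (x : α) × Fin (buckets q x)

/-- Flattening of one sample `x`: the pair `(x, y)` with `y` uniform in `[b_x]`. -/
def flattenSample {α : Type} [Fintype α] (q : PMF α) (x : α) : PMF (FlatDomain q) :=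
  (PMF.uniformOfFintype (Fin (buckets q x))).map fun y => ⟨x, y⟩

/-- The flattened version of the distribution `q` itself. -/
def flattened {α : Type} [Fintype α] (q : PMF α) : PMF (FlatDomain q) :=
  q.bind (flattenSample q)

/-- Independent flattening of every sample. -/
def flattenSamples {α : Type} [Fintype α] (q : PMF α) (S : List (List α)) :
    PMF (List (List (FlatDomain q))) :=
  drawEach (S.map fun l => drawEach (l.map (flattenSample q)))

/-- The law of the output of the identity tester combined with flattening: samples are drawn from
the original sources, each of them is flattened, and the verdict is that of the identity tester
for the flattened version of `q`. -/
def flattenedIdentityTester {α : Type} [Fintype α] [DecidableEq α] (c₁ : ℝ) (q : PMF α) (ε : ℝ)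
    (p : Fin (numSources c₁ (flattened q) ε) → PMF α) : PMF Verdict :=
  (drawSamples p).bind fun S => (flattenSamples q S).bind fun S' =>
    PMF.pure (verdict (numSources c₁ (flattened q) ε) (flattened q) ε S')

end MultiSource

end

noncomputable section

namespace MultiSource

open MeasureTheory ProbabilityTheory
open scoped Nat

section Draws

variable {α β : Type}

/-! ### Flattening commutes with drawing -/

/-! With Poissonized samples the counts `T_x` are independent Poisson variables with rates `λ_x = ∑ᵢ
pᵢ(x)` (`map_occurrences_drawSamples`). Put `d_x = λ_x - s q(x)`. Then `Z` has mean `E = ∑ d_x²` and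
variance `∑ (2 λ_x² + 4 λ_x d_x²)`, and Chebyshev's inequality (`two_thirds_le_pi_poisson`) decides
both cases.

If all sources equal `q`, the mean is `0` and the variance is `2 s² ‖q‖₂²`, small against the
squared threshold. In the far case the structural condition prevents cancellation between sources,
so `∑ |d_x| ≥ s ε` (`Structural.sum_abs_eq`), and Cauchy–Schwarz gives `E ≥ s² ε² / n`, which is
`8/5` of the threshold. The choice of `s` makes the standard deviation small against `E`.

Flattening samples amounts to sampling from flattened sources (`flattenedIdentityTester_eq`). It
preserves `ℓ₁`-distances and the structural condition, at most doubles the domain, and brings the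
`ℓ₂`-norm of `q` down to at most `1/√n`. -/

theorem drawEach_bind (f : α → PMF β) (ps : List (PMF α)) :
    ((drawEach ps).bind fun l => drawEach (l.map f)) = drawEach (ps.map fun p => p.bind f) := by
  induction ps with
  | nil => simp [drawEach]
  | cons p ps ih =>
    simp only [drawEach, List.map_cons, PMF.bind_bind, PMF.pure_bind, ← ih]
    congr 1
    funext x
    rw [PMF.bind_comm]

theorem drawEach_map_pure (l : List β) : drawEach (l.map PMF.pure) = PMF.pure l := by
  induction l with
  | nil => rfl
  | cons a l ih => simp [drawEach, ih]

theorem map_drawEach (f : α → β) (ps : List (PMF α)) :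
    (drawEach ps).map (List.map f) = drawEach (ps.map fun p => p.map f) := by
  have h := drawEach_bind (fun a => PMF.pure (f a)) ps
  have h2 : ∀ l : List α, drawEach (l.map fun a => PMF.pure (f a)) = PMF.pure (l.map f) := by
    intro l
    rw [← drawEach_map_pure, List.map_map]
    rfl
  simp only [h2] at h
  exact h

theorem poissonSamples_bind (f : α → PMF β) (p : PMF α) :
    ((poissonSamples p).bind fun l => drawEach (l.map f)) = poissonSamples (p.bind f) := by
  simp [poissonSamples, PMF.bind_bind, drawEach_bind]

theorem drawSamples_bind {s : ℕ} (f : α → PMF β) (p : Fin s → PMF α) :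
    ((drawSamples p).bind fun S => drawEach (S.map fun l => drawEach (l.map f))) =
      drawSamples fun i => (p i).bind f := by
  simp only [drawSamples, drawEach_bind, List.map_ofFn, Function.comp_def, poissonSamples_bind]

theorem drawSamples_map {s : ℕ} (f : α → β) (p : Fin s → PMF α) :
    (drawSamples p).map (List.map (List.map f)) = drawSamples fun i => (p i).map f := by
  simp only [drawSamples, map_drawEach, List.map_ofFn, Function.comp_def, poissonSamples,
    PMF.map_bind, List.map_replicate]

/-! ### Families of independent Poisson variables -/

/-- The joint law of independent Poisson variables with rates `r x`. -/
def poissonPi [Fintype α] (r : α → ℝ≥0) : PMF (α → ℕ) :=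
  (Measure.pi fun x => poissonMeasure (r x)).toPMF

theorem poisson_apply (r : ℝ≥0) (k : ℕ) :
    poisson r k = ENNReal.ofReal (Real.exp (-r) * r ^ k / k !) := by
  rw [poisson, Measure.toPMF_apply, poissonMeasure_singleton]

theorem poissonPi_apply [Fintype α] (r : α → ℝ≥0) (t : α → ℕ) :
    poissonPi r t = ∏ x, poisson (r x) (t x) := by
  rw [poissonPi, Measure.toPMF_apply, Measure.pi_singleton]
  rfl

theorem sum_poisson_mul_poisson (a b : ℝ≥0) (m : ℕ) :
    ∑ k ∈ Finset.range (m + 1), poisson a k * poisson b (m - k) = poisson (a + b) m := by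
  simp only [poisson_apply]
  have h : ∀ k ∈ Finset.range (m + 1),
      ENNReal.ofReal (Real.exp (-a) * a ^ k / k !) *
        ENNReal.ofReal (Real.exp (-b) * b ^ (m - k) / (m - k)!) =
      ENNReal.ofReal (Real.exp (-(a + b : ℝ)) / m ! *
        ((a : ℝ) ^ k * (b : ℝ) ^ (m - k) * m.choose k)) := by
    intro k hk
    rw [← ENNReal.ofReal_mul (by positivity)]
    congr 1
    rw [Nat.cast_choose ℝ (Nat.lt_succ_iff.mp (Finset.mem_range.mp hk)), neg_add, Real.exp_add]
    have := Nat.factorial_ne_zero m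
    field_simp
  rw [Finset.sum_congr rfl h, ← ENNReal.ofReal_sum_of_nonneg (fun _ _ => by positivity),
    ← Finset.mul_sum, ← add_pow]
  congr 1
  push_cast
  ring

/-- Only `u ≤ t` contributes to the mass at `t`, so the convolution is a sum over a box, which
factors into one-dimensional Poisson convolutions. -/
theorem poissonPi_bind_add [Fintype α] (r r' : α → ℝ≥0) :
    ((poissonPi r).bind fun u => (poissonPi r').map fun v => u + v) = poissonPi (r + r') := by
  classical
  ext t
  rw [PMF.bind_apply, tsum_eq_sum (s := Fintype.piFinset fun x => Finset.range (t x + 1))]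
  · rw [poissonPi_apply]
    simp only [Pi.add_apply, ← sum_poisson_mul_poisson]
    rw [Finset.prod_univ_sum]
    refine Finset.sum_congr rfl fun u hu => ?_
    rw [Finset.prod_mul_distrib, poissonPi_apply, PMF.map_apply, tsum_eq_single (t - u)]
    · have : t = u + (t - u) := by
        funext x
        have := Finset.mem_range.mp (Fintype.mem_piFinset.mp hu x)
        simp only [Pi.add_apply, Pi.sub_apply]
        omega
      rw [if_pos this, poissonPi_apply]
      rfl
    · intro v hv
      rw [if_neg]
      rintro rfl
      exact hv (by simp)
  · intro u hu
    rw [PMF.map_apply, ENNReal.tsum_eq_zero.mpr, mul_zero]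
    intro v
    rw [if_neg]
    rintro rfl
    exact hu (Fintype.mem_piFinset.mpr fun x => by simp)

theorem poissonPi_zero [Fintype α] : poissonPi (0 : α → ℝ≥0) = PMF.pure 0 := by
  ext t
  rw [poissonPi_apply, PMF.pure_apply]
  simp only [poisson_apply]
  split_ifs with h
  · subst h
    simp
  · obtain ⟨x, hx⟩ := Function.ne_iff.mp h
    refine Finset.prod_eq_zero (Finset.mem_univ x) ?_
    simp only [Pi.zero_apply] at hx
    simp [hx]

/-! ### The counts of Poissonized samples -/

section Counts

variable [Fintype α] [DecidableEq α]

/-- The probability that `k` draws from `p` have the counts `t` is a multinomial one. -/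
theorem map_count_drawEach_replicate (p : PMF α) (k : ℕ) (t : α → ℕ) :
    ((drawEach (List.replicate k p)).map fun l x => l.count x) t * ∏ x, ((t x)! : ℝ≥0∞) =
      if ∑ x, t x = k then (k ! : ℝ≥0∞) * ∏ x, p x ^ t x else 0 := by
  induction k generalizing t with
  | zero =>
    simp only [List.replicate_zero, drawEach, PMF.pure_map, PMF.pure_apply]
    by_cases h : t = 0
    · subst h
      simp [Pi.zero_def]
    · rw [if_neg (by simpa [funext_iff] using h), if_neg (by simpa [funext_iff] using h), zero_mul]
  | succ k ih =>
    have step : ((drawEach (List.replicate (k + 1) p)).map fun l x => l.count x) =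
        p.bind fun x => ((drawEach (List.replicate k p)).map fun l y => l.count y).map
          fun u => u + Pi.single x 1 := by
      simp only [List.replicate_succ, drawEach, PMF.map_bind, PMF.pure_map, PMF.map_comp]
      congr 1
      funext x
      rw [← PMF.bind_pure_comp]
      congr 1
      funext l
      simp only [Function.comp_apply]
      congr 1
      funext y
      by_cases h : y = x
      · simp [h]
      · simp [h, Ne.symm h]
    rw [step, PMF.bind_apply, tsum_fintype, Finset.sum_mul]
    -- Conditioning on the first draw: the outcome `x` contributes the share `t x` of the
    -- multinomial weight, and these shares add up to `k + 1`. Weighting by the factorials avoids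
    -- division in `ℝ≥0∞`.
    have term : ∀ x, p x * (((drawEach (List.replicate k p)).map fun l y => l.count y).map
          fun u => u + Pi.single x 1) t * ∏ y, ((t y)! : ℝ≥0∞) =
        if ∑ y, t y = k + 1 then (t x : ℝ≥0∞) * ((k ! : ℝ≥0∞) * ∏ y, p y ^ t y) else 0 := by
      intro x
      by_cases hx : t x = 0
      · rw [PMF.map_apply, ENNReal.tsum_eq_zero.mpr]
        · simp [hx]
        · intro u
          rw [if_neg]
          rintro rfl
          simp at hx
      · obtain ⟨u, rfl⟩ : ∃ u : α → ℕ, t = u + Pi.single x 1 := by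
          refine ⟨t - Pi.single x 1, ?_⟩
          funext y
          by_cases hy : y = x
          · subst hy
            simp
            omega
          · simp [hy]
        rw [PMF.map_apply, tsum_eq_single u]
        · have h1 : ∏ y, (((u + Pi.single x 1 : α → ℕ) y)! : ℝ≥0∞) =
              (u x + 1 : ℕ) * ∏ y, ((u y)! : ℝ≥0∞) := by
            rw [← Finset.mul_prod_erase _ _ (Finset.mem_univ x),
              ← Finset.mul_prod_erase Finset.univ (fun y => ((u y)! : ℝ≥0∞)) (Finset.mem_univ x),
              ← mul_assoc]
            congr 1
            · simp [Nat.factorial_succ]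
            · refine Finset.prod_congr rfl fun y hy => ?_
              simp [Finset.ne_of_mem_erase hy]
          have h2 : ∏ y, p y ^ (u + Pi.single x 1 : α → ℕ) y = p x * ∏ y, p y ^ u y := by
            simp only [Pi.add_apply, pow_add, Finset.prod_mul_distrib]
            rw [mul_comm]
            congr 1
            rw [Finset.prod_eq_single x] <;> simp +contextual
          have h3 : ∑ y, (u + Pi.single x 1 : α → ℕ) y = ∑ y, u y + 1 := by
            simp [Finset.sum_add_distrib]
          rw [if_pos rfl, h1, h2, h3]
          simp only [Nat.add_right_cancel_iff]
          have := ih u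
          calc _ = p x * (u x + 1 : ℕ) *
              (((drawEach (List.replicate k p)).map fun l y => l.count y) u *
                ∏ y, ((u y)! : ℝ≥0∞)) := by ring
            _ = _ := by
              rw [this]
              split_ifs
              · simp
                ring
              · simp
        · intro v hv
          rw [if_neg]
          intro h
          exact hv (add_right_cancel h).symm
    rw [Finset.sum_congr rfl fun x _ => term x]
    split_ifs with h
    · rw [← Finset.sum_mul, ← Nat.cast_sum, h, Nat.factorial_succ]
      push_cast
      ring
    · simp

/-- Poisson splitting: only `k = ∑ x, t x` contributes, the `k!` of the multinomial cancels that of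
the Poisson weight, and `exp (-1)` factors as `∏ exp (-p x)` because the masses sum to one. -/
theorem map_count_poissonSamples (p : PMF α) :
    ((poissonSamples p).map fun l x => l.count x) = poissonPi fun x => (p x).toNNReal := by
  ext t
  rw [poissonSamples, PMF.map_bind, PMF.bind_apply, poissonPi_apply]
  have hne : (∏ x, ((t x)! : ℝ≥0∞)) ≠ 0 := Finset.prod_ne_zero_iff.mpr fun x _ => by
    exact_mod_cast Nat.factorial_ne_zero _
  have htop : (∏ x, ((t x)! : ℝ≥0∞)) ≠ ∞ := ENNReal.prod_ne_top fun x _ => by simp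
  rw [← ENNReal.mul_left_inj hne htop, ← ENNReal.tsum_mul_right]
  simp only [mul_assoc, map_count_drawEach_replicate]
  rw [tsum_eq_single (∑ x, t x) (by intro b hb; simp [hb.symm]), if_pos rfl,
    ← Finset.prod_mul_distrib]
  have h1 : ∀ (r : ℝ≥0) (k : ℕ), poisson r k * (k ! : ℝ≥0∞) =
      ENNReal.ofReal (Real.exp (-r)) * (r : ℝ≥0∞) ^ k := by
    intro r k
    rw [poisson_apply, ← ENNReal.ofReal_natCast, ← ENNReal.ofReal_mul (by positivity),
      div_mul_cancel₀ _ (by positivity), ENNReal.ofReal_mul (by positivity),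
      ENNReal.ofReal_pow (by positivity), ENNReal.ofReal_coe_nnreal]
  have hsum : ∑ x, ((p x).toNNReal : ℝ) = 1 := by
    have := p.tsum_coe
    rw [tsum_fintype] at this
    have h := congrArg ENNReal.toReal this
    rw [ENNReal.toReal_sum fun x _ => p.apply_ne_top x] at h
    rw [ENNReal.toReal_one] at h
    exact h
  rw [← mul_assoc, h1]
  simp only [h1, Finset.prod_mul_distrib]
  rw [← ENNReal.ofReal_prod_of_nonneg (fun _ _ => by positivity), ← Real.exp_sum,
    Finset.sum_neg_distrib, hsum]
  simp [ENNReal.coe_toNNReal (p.apply_ne_top _)]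

theorem map_occurrences_drawEach {ps : List (PMF (List α))}
    {rs : List (α → ℝ≥0)}
    (h : List.Forall₂ (fun p r => (p.map fun l x => l.count x) = poissonPi r) ps rs) :
    (drawEach ps).map occurrences = poissonPi rs.sum := by
  induction h with
  | nil =>
    rw [List.sum_nil, poissonPi_zero, drawEach, PMF.pure_map]
    rfl
  | @cons p r ps rs hp _ ih =>
    rw [List.sum_cons, ← poissonPi_bind_add, ← ih, ← hp, PMF.bind_map, drawEach, PMF.map_bind]
    congr 1
    funext l
    rw [PMF.map_bind, Function.comp_apply, PMF.map_comp]
    rw [← PMF.bind_pure_comp]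
    congr 1
    funext S
    rw [PMF.pure_map, Function.comp_apply, Function.comp_apply]
    congr 1
    funext x
    simp [occurrences]

theorem map_occurrences_drawSamples {s : ℕ} (p : Fin s → PMF α) :
    (drawSamples p).map occurrences = poissonPi fun x => ∑ i, (p i x).toNNReal := by
  rw [drawSamples, map_occurrences_drawEach
    (rs := List.ofFn fun i x => (p i x).toNNReal), List.sum_ofFn]
  · congr 1
    funext x
    simp
  · rw [List.forall₂_iff_get]
    refine ⟨by simp, fun i h1 h2 => ?_⟩
    simp [map_count_poissonSamples]

end Counts

/-- Collapsing the domain to one point turns the total into a single occurrence count, whose rate is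
`s`. -/
theorem map_numSamples_drawSamples {s : ℕ} (p : Fin s → PMF α) :
    (drawSamples p).map numSamples = poisson s := by
  have h1 : (drawSamples p).map numSamples =
      ((drawSamples fun i => (p i).map fun _ => ()).map occurrences).map fun t => t () := by
    rw [← drawSamples_map, PMF.map_comp, PMF.map_comp]
    congr 1
    funext S
    simp [numSamples, occurrences, ← List.map_flatten]
  rw [h1, map_occurrences_drawSamples]
  have h2 : ∀ i, (p i).map (fun _ => ()) = PMF.pure () := fun i => PMF.map_const _ _
  ext k
  rw [PMF.map_apply, tsum_eq_single fun _ => k]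
  · simp [poissonPi_apply, h2]
  · intro t ht
    rw [if_neg]
    rintro rfl
    exact ht rfl

end Draws

/-! ### Moments of Poisson variables -/

/-- Shifting the index by `j` cancels the descending factorial and leaves `r ^ j` times the total
mass. Moments of polynomials are therefore computed in the basis of descending factorials. -/
theorem hasSum_poisson_descFactorial (r : ℝ≥0) (j : ℕ) :
    HasSum (fun k : ℕ => Real.exp (-r) * (r : ℝ) ^ k / k ! * (k.descFactorial j : ℝ))
      ((r : ℝ) ^ j) := by
  have h : HasSum (fun m : ℕ => Real.exp (-r) * (r : ℝ) ^ (m + j) / (m + j)! *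
      ((m + j).descFactorial j : ℝ)) ((r : ℝ) ^ j) := by
    have h1 := (hasSum_one_poissonMeasure r).mul_left ((r : ℝ) ^ j)
    rw [mul_one] at h1
    refine h1.congr_fun fun m => ?_
    have h2 : ((m + j)! : ℝ) = (m ! : ℝ) * ((m + j).descFactorial j : ℝ) := by
      have := Nat.factorial_mul_descFactorial (Nat.le_add_left j m)
      rw [Nat.add_sub_cancel] at this
      exact_mod_cast this.symm
    have h3 : ((m + j).descFactorial j : ℝ) ≠ 0 := by
      have := (Nat.descFactorial_eq_zero_iff_lt (n := m + j) (k := j)).not.mpr (by omega)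
      exact_mod_cast this
    have h4 : (m ! : ℝ) ≠ 0 := by exact_mod_cast Nat.factorial_ne_zero m
    rw [h2]
    field_simp
    ring
  refine ((add_left_injective j).hasSum_iff fun k hk => ?_).mp h
  have : k < j := by
    by_contra! hjk
    exact hk ⟨k - j, Nat.sub_add_cancel hjk⟩
  rw [Nat.descFactorial_of_lt this]
  simp

theorem integrable_descFactorial (r : ℝ≥0) (j : ℕ) :
    Integrable (fun k : ℕ => (k.descFactorial j : ℝ)) (poissonMeasure r) := by
  rw [integrable_poissonMeasure_iff]
  simpa using (hasSum_poisson_descFactorial r j).summable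

theorem integral_descFactorial (r : ℝ≥0) (j : ℕ) :
    ∫ k : ℕ, (k.descFactorial j : ℝ) ∂poissonMeasure r = (r : ℝ) ^ j := by
  rw [integral_poissonMeasure]
  exact (hasSum_poisson_descFactorial r j).tsum_eq

theorem cast_descFactorial_succ (k j : ℕ) :
    (k.descFactorial (j + 1) : ℝ) = (k - j) * k.descFactorial j := by
  rw [Nat.descFactorial_succ]
  rcases le_or_gt j k with h | h
  · push_cast [h]
    ring
  · simp [Nat.descFactorial_of_lt h]

/-- The contribution `(k - μ)² - k` of one domain element to the statistic. -/
def coordStatistic (μ : ℝ) (k : ℕ) : ℝ := ((k : ℝ) - μ) ^ 2 - k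

theorem integrable_sum_descFactorial (r : ℝ≥0) {m : ℕ} (a : Fin m → ℝ) :
    Integrable (fun k : ℕ => ∑ j, a j * (k.descFactorial j : ℝ)) (poissonMeasure r) :=
  integrable_finsetSum _ fun j _ => (integrable_descFactorial r j).const_mul _

theorem integral_sum_descFactorial (r : ℝ≥0) {m : ℕ} (a : Fin m → ℝ) :
    ∫ k : ℕ, ∑ j, a j * (k.descFactorial j : ℝ) ∂poissonMeasure r = ∑ j, a j * (r : ℝ) ^ (j : ℕ) := by
  rw [integral_finsetSum _ fun (j : Fin m) _ => (integrable_descFactorial r j).const_mul (a j)]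
  simp only [integral_const_mul, integral_descFactorial]

/-- Since `k² - k` is the second descending factorial, subtracting `k` is what makes the mean
exactly `(r - μ)²`. -/
theorem coordStatistic_eq (μ : ℝ) : coordStatistic μ =
    fun k => ∑ j : Fin 3, ![μ ^ 2, -2 * μ, 1] j * (k.descFactorial j : ℝ) := by
  funext k
  simp [coordStatistic, Fin.sum_univ_succ, cast_descFactorial_succ, -Nat.descFactorial_succ]
  ring

theorem coordStatistic_sq_eq (μ : ℝ) : (fun k => coordStatistic μ k ^ 2) =
    fun k => ∑ j : Fin 5, ![μ ^ 4, 4 * μ ^ 2 - 4 * μ ^ 3, 2 - 8 * μ + 6 * μ ^ 2, 4 - 4 * μ, 1] j *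
      (k.descFactorial j : ℝ) := by
  funext k
  simp [coordStatistic, Fin.sum_univ_succ, cast_descFactorial_succ, -Nat.descFactorial_succ]
  ring

theorem memLp_coordStatistic (r : ℝ≥0) (μ : ℝ) :
    MemLp (coordStatistic μ) 2 (poissonMeasure r) := by
  rw [memLp_two_iff_integrable_sq .of_discrete, coordStatistic_sq_eq]
  exact integrable_sum_descFactorial _ _

theorem integral_coordStatistic (r : ℝ≥0) (μ : ℝ) :
    ∫ k, coordStatistic μ k ∂poissonMeasure r = (r - μ) ^ 2 := by
  rw [coordStatistic_eq, integral_sum_descFactorial]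
  simp [Fin.sum_univ_succ]
  ring

theorem variance_coordStatistic (r : ℝ≥0) (μ : ℝ) :
    variance (coordStatistic μ) (poissonMeasure r) = 2 * r ^ 2 + 4 * r * (r - μ) ^ 2 := by
  rw [variance_eq_sub (memLp_coordStatistic r μ), integral_coordStatistic]
  have : (coordStatistic μ ^ 2) = fun k => coordStatistic μ k ^ 2 := rfl
  rw [this, coordStatistic_sq_eq, integral_sum_descFactorial]
  simp [Fin.sum_univ_succ]
  ring

/-- Chebyshev's inequality for the statistic of independent Poisson counts. -/
theorem two_thirds_le_pi_poisson {α : Type} [Fintype α] (r : α → ℝ≥0) (μ : α → ℝ)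
    {c : ℝ} (hc : 0 < c) (S : Set (α → ℕ))
    (hS : ∀ t ∉ S, c ≤ |∑ x, coordStatistic (μ x) (t x) - ∑ x, ((r x : ℝ) - μ x) ^ 2|)
    (hV : ∑ x, (2 * (r x : ℝ) ^ 2 + 4 * r x * (r x - μ x) ^ 2) ≤ c ^ 2 / 3) :
    2 / 3 ≤ Measure.pi (fun x => poissonMeasure (r x)) S := by
  set P := Measure.pi (fun x => poissonMeasure (r x)) with hP
  have hmem : ∀ x, MemLp (coordStatistic (μ x)) 2 (poissonMeasure (r x)) :=
    fun x => memLp_coordStatistic _ _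
  have hmem' : ∀ x, MemLp (fun t : α → ℕ => coordStatistic (μ x) (t x)) 2 P :=
    fun x => (hmem x).comp_measurePreserving (measurePreserving_eval _ x)
  have hZ : MemLp (∑ x, fun t : α → ℕ => coordStatistic (μ x) (t x)) 2 P :=
    memLp_finsetSum' _ fun x _ => hmem' x
  have hvar := variance_sum_pi hmem
  simp only [variance_coordStatistic] at hvar
  have hmean : ∫ t, (∑ x, fun t : α → ℕ => coordStatistic (μ x) (t x)) t ∂P =
      ∑ x, ((r x : ℝ) - μ x) ^ 2 := by
    simp only [Finset.sum_apply]
    rw [integral_finsetSum _ fun x _ => (hmem' x).integrable (by norm_num)]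
    refine Finset.sum_congr rfl fun x _ => ?_
    rw [hP, integral_comp_eval (μ := fun x => poissonMeasure (r x)) (i := x)
      (f := coordStatistic (μ x)) .of_discrete, integral_coordStatistic]
  have hcheb := meas_ge_le_variance_div_sq hZ hc
  rw [hmean, hvar] at hcheb
  have hcompl : P Sᶜ ≤ 1 / 3 := by
    calc P Sᶜ ≤ _ := measure_mono fun t ht => by simpa using hS t ht
      _ ≤ _ := hcheb
      _ ≤ ENNReal.ofReal (1 / 3) := by
        refine ENNReal.ofReal_le_ofReal ?_
        rw [div_le_iff₀ (by positivity)]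
        linarith
      _ = 1 / 3 := by
        rw [ENNReal.ofReal_div_of_pos (by norm_num)]
        simp
  have hone : P S + P Sᶜ = 1 := by
    rw [measure_add_measure_compl MeasurableSet.of_discrete, measure_univ]
  have h3 : (2 / 3 : ℝ≥0∞) + 1 / 3 = 1 := by
    rw [ENNReal.div_add_div_same]
    norm_num
    exact ENNReal.div_self (by norm_num) (by norm_num)
  by_contra! hlt
  have : P S + P Sᶜ < 2 / 3 + 1 / 3 :=
    ENNReal.add_lt_add_of_lt_of_le (ne_top_of_le_ne_top (by simp) hcompl) hlt hcompl
  rw [hone, h3] at this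
  exact lt_irrefl _ this

/-! ### The identity tester -/

section Tester

variable {α : Type} [Fintype α]

theorem sum_toReal (q : PMF α) : ∑ x, (q x).toReal = 1 := by
  rw [← ENNReal.toReal_sum fun x _ => q.apply_ne_top x, ← tsum_fintype (L := .unconditional _),
    q.tsum_coe, ENNReal.toReal_one]

theorem card_pos_of_pmf (q : PMF α) : 0 < Fintype.card α :=
  Fintype.card_pos_iff.mpr q.support_nonempty.to_type

theorem l2Norm_sq (q : PMF α) : l2Norm q ^ 2 = ∑ x, (q x).toReal ^ 2 :=
  Real.sq_sqrt (Finset.sum_nonneg fun _ _ => sq_nonneg _)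

theorem l2Norm_nonneg (q : PMF α) : 0 ≤ l2Norm q := Real.sqrt_nonneg _

theorem le_l2Norm (q : PMF α) (x : α) : (q x).toReal ≤ l2Norm q := by
  refine Real.le_sqrt_of_sq_le ?_
  exact Finset.single_le_sum (f := fun x => (q x).toReal ^ 2) (fun _ _ => sq_nonneg _)
    (Finset.mem_univ x)

theorem one_le_card_mul_l2Norm_sq (q : PMF α) : 1 ≤ Fintype.card α * l2Norm q ^ 2 := by
  have := sq_sum_le_card_mul_sum_sq (s := Finset.univ) (f := fun x => (q x).toReal)
  rwa [sum_toReal, one_pow, ← l2Norm_sq] at this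

theorem l1Dist_le_two (p q : PMF α) : l1Dist p q ≤ 2 := by
  calc l1Dist p q ≤ ∑ x, ((p x).toReal + (q x).toReal) := Finset.sum_le_sum fun x _ => by
        refine (abs_sub _ _).trans ?_
        simp
    _ = 2 := by rw [Finset.sum_add_distrib, sum_toReal, sum_toReal]; norm_num

theorem card_mul_l2Norm_le {c : ℝ} (q : PMF α) {ε : ℝ} (hε : 0 < ε) :
    c * (Fintype.card α * l2Norm q) ≤ numSources c q ε * ε ^ 2 := by
  have := Nat.le_ceil (c * Fintype.card α * l2Norm q / ε ^ 2)
  rw [div_le_iff₀ (by positivity)] at this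
  rw [← mul_assoc]
  exact this

theorem l2Norm_pos (q : PMF α) : 0 < l2Norm q := by
  refine (l2Norm_nonneg q).lt_of_ne fun h => ?_
  have := one_le_card_mul_l2Norm_sq q
  rw [← h] at this
  norm_num at this

theorem numSources_pos {c : ℝ} (hc : 0 < c) (q : PMF α) {ε : ℝ} (hε : 0 < ε) :
    0 < numSources c q ε := by
  have h1 := card_pos_of_pmf q
  have h2 := l2Norm_pos q
  rw [numSources, Nat.ceil_pos]
  positivity

/-- Under the structural condition the `ℓ₁`-distances of the sources add up. -/
theorem Structural.sum_abs_eq {s : ℕ} {p : Fin s → PMF α} {q : PMF α} (h : Structural p q) :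
    ∑ x, |∑ i, (p i x).toReal - s * (q x).toReal| = ∑ i, l1Dist (p i) q := by
  obtain ⟨A, hA⟩ := h
  simp only [l1Dist]
  rw [Finset.sum_comm]
  refine Finset.sum_congr rfl fun x _ => ?_
  have h1 : ∑ i, (p i x).toReal - s * (q x).toReal = ∑ i, ((p i x).toReal - (q x).toReal) := by
    simp [Finset.sum_sub_distrib]
  rw [h1]
  -- The sign of `p i x - q x` does not depend on `i`, so absolute values pass through the sum over
  -- sources.
  by_cases hx : x ∈ A
  · have h2 : ∀ i, 0 ≤ (p i x).toReal - (q x).toReal := fun i => sub_nonneg.mpr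
      (ENNReal.toReal_mono ((p i).apply_ne_top x) ((hA i).1 x hx))
    rw [abs_of_nonneg (Finset.sum_nonneg fun i _ => h2 i)]
    exact Finset.sum_congr rfl fun i _ => (abs_of_nonneg (h2 i)).symm
  · have h2 : ∀ i, (p i x).toReal - (q x).toReal ≤ 0 := fun i => sub_nonpos.mpr
      (ENNReal.toReal_mono (q.apply_ne_top x) ((hA i).2 x hx))
    rw [abs_of_nonpos (Finset.sum_nonpos fun i _ => h2 i), ← Finset.sum_neg_distrib]
    exact Finset.sum_congr rfl fun i _ => (abs_of_nonpos (h2 i)).symm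

variable [DecidableEq α]

open Classical in
/-- The law of the verdict in terms of independent Poisson counts. -/
theorem identityTester_apply (c : ℝ) (q : PMF α) (ε : ℝ)
    (p : Fin (numSources c q ε) → PMF α) (v : Verdict) :
    identityTester c q ε p v =
      Measure.pi (fun x => poissonMeasure (∑ i, (p i x).toNNReal))
        {t | (if threshold (Fintype.card α) (numSources c q ε) ε ≤
          ∑ x, coordStatistic (numSources c q ε * (q x).toReal) (t x)
          then Verdict.reject else Verdict.accept) = v} := by
  set f : (α → ℕ) → Verdict := fun t =>
    if threshold (Fintype.card α) (numSources c q ε) ε ≤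
      ∑ x, coordStatistic (numSources c q ε * (q x).toReal) (t x)
      then Verdict.reject else Verdict.accept with hf
  have h1 : identityTester c q ε p = ((drawSamples p).map occurrences).map f := by
    rw [PMF.map_comp]
    rfl
  rw [h1, map_occurrences_drawSamples, ← PMF.toOuterMeasure_apply_singleton,
    PMF.toOuterMeasure_map_apply, ← PMF.toMeasure_apply_eq_toOuterMeasure, poissonPi,
    Measure.toPMF_toMeasure]
  rfl

theorem identityTester_accept (q : PMF α) {ε : ℝ} (hε : 0 < ε)
    (p : Fin (numSources 1000 q ε) → PMF α) (hp : ∀ i, p i = q) :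
    2 / 3 ≤ identityTester 1000 q ε p Verdict.accept := by
  rw [identityTester_apply]
  have hs := numSources_pos (c := 1000) (by norm_num) q hε
  have hcs := card_mul_l2Norm_le (c := 1000) q hε
  revert hs hcs
  -- Only the two bounds on the number of sources matter from here on; `p` is reverted because its
  -- type depends on that number.
  revert p
  generalize numSources 1000 q ε = s
  intro p hp hs hcs
  have hn : (0 : ℝ) < Fintype.card α := by exact_mod_cast card_pos_of_pmf q
  have hs' : (0 : ℝ) < s := by exact_mod_cast hs
  have hrate : ∀ x, ((∑ i, (p i x).toNNReal : ℝ≥0) : ℝ) = s * (q x).toReal := by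
    intro x
    simp only [hp]
    simp [ENNReal.toReal]
  refine two_thirds_le_pi_poisson _ (fun x => s * (q x).toReal)
    (c := threshold (Fintype.card α) s ε) (by unfold threshold; positivity) _ ?_ ?_
  · intro t ht
    simp only [Set.mem_ofPred_eq, ite_eq_right_iff, reduceCtorEq, imp_false, not_not] at ht
    simp only [hrate, sub_self]
    simpa using ht.trans (le_abs_self _)
  · simp only [hrate, sub_self]
    have hV : ∑ x, (2 * (s * (q x).toReal) ^ 2 + 4 * (s * (q x).toReal) * 0 ^ 2) =
        2 * (s * l2Norm q) ^ 2 := by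
      rw [mul_pow _ (l2Norm q), l2Norm_sq, Finset.mul_sum, Finset.mul_sum]
      refine Finset.sum_congr rfl fun x _ => by ring
    rw [hV]
    -- The choice of `s` even gives `τ / 625`; `τ / 3` suffices, as `2/9 ≤ 1/3`.
    have hle : s * l2Norm q ≤ threshold (Fintype.card α) s ε / 3 := by
      rw [threshold, div_div, le_div_iff₀ (by positivity)]
      nlinarith [mul_le_mul_of_nonneg_left hcs hs'.le, mul_pos hs' (mul_pos hn (l2Norm_pos q))]
    have h0 : 0 ≤ s * l2Norm q := mul_nonneg hs'.le (l2Norm_nonneg q)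
    have := pow_le_pow_left₀ h0 hle 2
    nlinarith

theorem identityTester_reject (q : PMF α) {ε : ℝ} (hε : 0 < ε)
    (p : Fin (numSources 1000 q ε) → PMF α) (hstr : Structural p q)
    (hfar : ∀ i, ε ≤ l1Dist (p i) q) :
    2 / 3 ≤ identityTester 1000 q ε p Verdict.reject := by
  rw [identityTester_apply]
  have hs := numSources_pos (c := 1000) (by norm_num) q hε
  have hcs := card_mul_l2Norm_le (c := 1000) q hε
  -- There is at least one source, so the farness hypothesis is not vacuous and bounds `ε`.
  have hε2 : ε ≤ 2 := (hfar ⟨0, hs⟩).trans (l1Dist_le_two _ _)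
  revert hs hcs
  revert p
  generalize numSources 1000 q ε = s
  intro p hstr hfar hs hcs
  have hn : (0 : ℝ) < Fintype.card α := by exact_mod_cast card_pos_of_pmf q
  have hs' : (0 : ℝ) < s := by exact_mod_cast hs
  have hsum := hstr.sum_abs_eq
  have hfar' : s * ε ≤ ∑ i, l1Dist (p i) q := by
    have := Finset.sum_le_sum fun i (_ : i ∈ Finset.univ) => hfar i
    simpa using this
  rw [← hsum] at hfar'
  have hrate : ∀ x, ((∑ i, (p i x).toNNReal : ℝ≥0) : ℝ) = ∑ i, (p i x).toReal := by
    intro x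
    push_cast
    rfl
  set n : ℝ := (Fintype.card α : ℝ) with hn_def
  set L := l2Norm q with hL
  have hL0 : 0 < L := l2Norm_pos q
  set d : α → ℝ := fun x => ∑ i, (p i x).toReal - s * (q x).toReal with hd
  set E := ∑ x, d x ^ 2 with hE
  have hE0 : 0 ≤ E := Finset.sum_nonneg fun _ _ => sq_nonneg _
  have hnE : (s * ε) ^ 2 ≤ n * E := by
    have h1 := sq_sum_le_card_mul_sum_sq (s := Finset.univ) (f := fun x => |d x|)
    simp only [sq_abs] at h1
    exact (pow_le_pow_left₀ (by positivity) hfar' 2).trans h1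
  have hEpos : 0 < E := by
    have : 0 < n * E := lt_of_lt_of_le (by positivity) hnE
    exact pos_of_mul_pos_right this hn.le
  have hsL : s * L ≤ E / 1000 := by
    have h1 : n * (1000 * (s * L)) ≤ n * E := by nlinarith
    have := le_of_mul_le_mul_left h1 hn
    linarith
  -- From `n E ≥ s² ε² ≥ s² ε⁴ / 4 ≥ (1000 n L)² / 4` and `n L² ≥ 1`. This lower bound lets `E²`
  -- absorb the terms of order `E` and `E^(3/2)` in the variance.
  have hR : 500 ≤ √E := by
    have h1 : 1 ≤ n * L ^ 2 := one_le_card_mul_l2Norm_sq q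
    have h2 : (1000 * (n * L)) ^ 2 ≤ (s * ε ^ 2) ^ 2 := pow_le_pow_left₀ (by positivity) hcs 2
    have h3 : (s * ε ^ 2) ^ 2 ≤ n * E * 4 := by
      calc (s * ε ^ 2) ^ 2 = (s * ε) ^ 2 * ε ^ 2 := by ring
        _ ≤ n * E * 4 := by
          refine mul_le_mul hnE ?_ (by positivity) (by positivity)
          nlinarith
    have h4 : n * 1000000 ≤ n * (E * 4) := by nlinarith
    have h5 := le_of_mul_le_mul_left h4 hn
    refine Real.le_sqrt_of_sq_le ?_
    linarith
  have hRsq : √E ^ 2 = E := Real.sq_sqrt hE0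
  have hτ : threshold (Fintype.card α) s ε ≤ 5 / 8 * E := by
    rw [threshold, ← hn_def, div_le_iff₀ (by positivity)]
    nlinarith
  -- The threshold is at most `5/8 E`, so acceptance forces a deviation of at least `3/8 E` from the
  -- mean.
  refine two_thirds_le_pi_poisson _ (fun x => s * (q x).toReal)
    (c := 3 / 8 * E) (by positivity) _ ?_ ?_
  · intro t ht
    simp only [Set.mem_ofPred_eq, ite_eq_left_iff, reduceCtorEq, imp_false, not_not, not_le] at ht
    simp only [hrate]
    rw [abs_sub_comm]
    refine le_trans ?_ (le_abs_self _)
    linarith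
  · simp only [hrate]
    have hdle : ∀ x, d x ≤ √E := fun x => Real.le_sqrt_of_sq_le
      (Finset.single_le_sum (f := fun x => d x ^ 2) (fun _ _ => sq_nonneg _) (Finset.mem_univ x))
    -- With `λ = s q + d`: `2 λ² ≤ 4 (s q)² + 4 d²`, and `λ ≤ s L + √E` in the cubic term.
    have hterm : ∀ x, 2 * (∑ i, (p i x).toReal) ^ 2 + 4 * (∑ i, (p i x).toReal) *
        (∑ i, (p i x).toReal - s * (q x).toReal) ^ 2 ≤
        4 * s ^ 2 * (q x).toReal ^ 2 + (4 + 4 * (s * L) + 4 * √E) * d x ^ 2 := by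
      intro x
      have h1 : ∑ i, (p i x).toReal = s * (q x).toReal + d x := by simp [hd]
      have h2 : s * (q x).toReal ≤ s * L := mul_le_mul_of_nonneg_left (le_l2Norm q x) hs'.le
      rw [h1, add_sub_cancel_left]
      nlinarith [mul_le_mul_of_nonneg_right (add_le_add h2 (hdle x)) (sq_nonneg (d x)),
        sq_nonneg (s * (q x).toReal - d x)]
    refine (Finset.sum_le_sum fun x _ => hterm x).trans ?_
    rw [Finset.sum_add_distrib, ← Finset.mul_sum, ← Finset.mul_sum, ← l2Norm_sq, ← hL, ← hE]
    have h1 : (s * L) ^ 2 ≤ (E / 1000) ^ 2 := pow_le_pow_left₀ (by positivity) hsL 2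
    have h2 : (4 + 4 * (s * L) + 4 * √E) * E ≤ (4 + 4 * (E / 1000) + 4 * (E / 500)) * E := by
      refine mul_le_mul_of_nonneg_right ?_ hE0
      nlinarith
    have h3 : 250000 ≤ E := by nlinarith
    nlinarith

end Tester

/-! ### Flattening -/

section Flattening

variable {α : Type} [Fintype α]

theorem bind_flattenSample_apply (q p : PMF α) (z : FlatDomain q) :
    p.bind (flattenSample q) z = p z.1 * (buckets q z.1 : ℝ≥0∞)⁻¹ := by
  obtain ⟨x, y⟩ := z
  rw [PMF.bind_apply, tsum_eq_single x]
  · rw [flattenSample, PMF.map_apply, tsum_eq_single y]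
    · simp
    · intro y' hy'
      rw [if_neg]
      intro h
      exact hy' (by simpa using h.symm)
  · intro x' hx'
    rw [flattenSample, PMF.map_apply, ENNReal.tsum_eq_zero.mpr, mul_zero]
    intro y'
    rw [if_neg]
    intro h
    exact hx' (congrArg Sigma.fst h).symm

theorem toReal_bind_flattenSample (q p : PMF α) (z : FlatDomain q) :
    (p.bind (flattenSample q) z).toReal = (p z.1).toReal * (buckets q z.1 : ℝ)⁻¹ := by
  rw [bind_flattenSample_apply, ENNReal.toReal_mul, ENNReal.toReal_inv, ENNReal.toReal_natCast]

theorem sum_flatDomain (q : PMF α) (f : α → ℝ) :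
    ∑ z : FlatDomain q, f z.1 = ∑ x, (buckets q x : ℝ) * f x := by
  rw [Fintype.sum_sigma]
  simp

theorem buckets_pos (q : PMF α) (x : α) : (0 : ℝ) < buckets q x := by positivity

theorem l1Dist_flatten (q p p' : PMF α) :
    l1Dist (p.bind (flattenSample q)) (p'.bind (flattenSample q)) = l1Dist p p' := by
  simp only [l1Dist, toReal_bind_flattenSample]
  rw [sum_flatDomain q fun x => |(p x).toReal * (buckets q x : ℝ)⁻¹ -
    (p' x).toReal * (buckets q x : ℝ)⁻¹|]
  refine Finset.sum_congr rfl fun x _ => ?_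
  have := buckets_pos q x
  rw [← sub_mul, abs_mul, abs_of_pos (inv_pos.mpr this)]
  field_simp

theorem Structural.flatten {s : ℕ} {p : Fin s → PMF α} {q : PMF α} (h : Structural p q) :
    Structural (fun i => (p i).bind (flattenSample q)) (flattened q) := by
  obtain ⟨A, hA⟩ := h
  refine ⟨{z | z.1 ∈ A}, fun i => ⟨fun z hz => ?_, fun z hz => ?_⟩⟩
  · rw [flattened, bind_flattenSample_apply, bind_flattenSample_apply]
    exact mul_le_mul_left ((hA i).1 z.1 hz) _
  · rw [flattened, bind_flattenSample_apply, bind_flattenSample_apply]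
    exact mul_le_mul_left ((hA i).2 z.1 hz) _

theorem card_flatDomain_le (q : PMF α) :
    (Fintype.card (FlatDomain q) : ℝ) ≤ 2 * Fintype.card α := by
  have h1 : (Fintype.card (FlatDomain q) : ℝ) = ∑ x, (buckets q x : ℝ) := by
    simp
  have h2 : ∀ x, (buckets q x : ℝ) ≤ Fintype.card α * (q x).toReal + 1 := by
    intro x
    have := Nat.floor_le (a := (Fintype.card α : ℝ) * (q x).toReal) (by positivity)
    push_cast
    linarith
  rw [h1]
  refine (Finset.sum_le_sum fun x _ => h2 x).trans ?_
  rw [Finset.sum_add_distrib, ← Finset.mul_sum, sum_toReal]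
  simp
  linarith

/-- The `b_x` cells over `x` together contribute `n q(x)² / b_x`, at most `q(x)` because `b_x ≥ n
q(x)`. -/
theorem card_mul_l2Norm_flattened_sq_le (q : PMF α) :
    Fintype.card α * l2Norm (flattened q) ^ 2 ≤ 1 := by
  rw [l2Norm_sq]
  simp only [flattened, toReal_bind_flattenSample]
  rw [sum_flatDomain q fun x => ((q x).toReal * (buckets q x : ℝ)⁻¹) ^ 2, Finset.mul_sum,
    ← sum_toReal q]
  refine Finset.sum_le_sum fun x _ => ?_
  have hb := buckets_pos q x
  have h1 : (Fintype.card α : ℝ) * (q x).toReal ≤ buckets q x := by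
    push_cast
    exact (Nat.lt_floor_add_one _).le
  calc (Fintype.card α : ℝ) * (buckets q x * ((q x).toReal * (buckets q x : ℝ)⁻¹) ^ 2)
      = (Fintype.card α * (q x).toReal) * (buckets q x : ℝ)⁻¹ * (q x).toReal := by
        field_simp
    _ ≤ buckets q x * (buckets q x : ℝ)⁻¹ * (q x).toReal := by gcongr
    _ = (q x).toReal := by field_simp

theorem numSources_flattened_le {c : ℝ} (hc : 0 ≤ c) (q : PMF α) {ε : ℝ} (hε : 0 < ε)
    (hε2 : ε ≤ 2) :
    (numSources c (flattened q) ε : ℝ) ≤ (2 * c + 4) * √(Fintype.card α) / ε ^ 2 := by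
  set n : ℝ := (Fintype.card α : ℝ) with hn
  have hn1 : 1 ≤ n := Nat.one_le_cast.mpr (card_pos_of_pmf q)
  have hsq : √n ^ 2 = n := Real.sq_sqrt (by linarith)
  have hn2 : 1 ≤ √n := Real.one_le_sqrt.mpr hn1
  set L := l2Norm (flattened q)
  have hL0 : 0 ≤ L := l2Norm_nonneg _
  have hL : √n * L ≤ 1 := by
    have h1 : n * L ^ 2 ≤ 1 := card_mul_l2Norm_flattened_sq_le q
    rw [← hsq, ← mul_pow] at h1
    exact (sq_le_one_iff₀ (by positivity)).mp h1
  have hD : Fintype.card (FlatDomain q) * L ≤ 2 * √n := by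
    calc Fintype.card (FlatDomain q) * L ≤ 2 * n * L :=
          mul_le_mul_of_nonneg_right (card_flatDomain_le q) hL0
      _ = 2 * √n * (√n * L) := by linear_combination (-2 * L) * hsq
      _ ≤ 2 * √n * 1 := by gcongr
      _ = 2 * √n := mul_one _
  have hceil := (Nat.ceil_lt_add_one
    (a := c * Fintype.card (FlatDomain q) * L / ε ^ 2) (by positivity)).le
  refine hceil.trans ?_
  rw [div_add_one (by positivity)]
  refine div_le_div_of_nonneg_right ?_ (by positivity)
  -- The summand `4` in the constant pays for rounding up: `ε² ≤ 4 ≤ 4 √n`.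
  nlinarith [mul_le_mul_of_nonneg_left hD hc]

/-- Independent randomization of each sample commutes with drawing, which reduces the flattened
tester to the plain one on the domain `D`. -/
theorem flattenedIdentityTester_eq [DecidableEq α] (c : ℝ) (q : PMF α) (ε : ℝ)
    (p : Fin (numSources c (flattened q) ε) → PMF α) :
    flattenedIdentityTester c q ε p =
      identityTester c (flattened q) ε fun i => (p i).bind (flattenSample q) := by
  rw [flattenedIdentityTester, identityTester, ← drawSamples_bind, PMF.bind_bind]
  rfl

end Flattening

end MultiSource

end

theorem theorem3 :
    ∃ c₁ : ℝ, 0 < c₁ ∧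
      -- the identity tester, with `s = ⌈c₁ n ‖q‖₂ / ε²⌉` sources
      (∀ (n : ℕ) (q : PMF (Fin n)) (ε : ℝ), 0 < ε →
        ∀ p : Fin (MultiSource.numSources c₁ q ε) → PMF (Fin n),
          ((∀ i, p i = q) →
            2 / 3 ≤ MultiSource.identityTester c₁ q ε p MultiSource.Verdict.accept) ∧
          (MultiSource.Structural p q → (∀ i, ε ≤ MultiSource.l1Dist (p i) q) →
            2 / 3 ≤ MultiSource.identityTester c₁ q ε p MultiSource.Verdict.reject)) ∧
      -- the same tester after flattening, with `O(√n / ε²)` sources and samples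
      ∃ C : ℝ, 0 < C ∧
        ∀ (n : ℕ) (q : PMF (Fin n)) (ε : ℝ), 0 < ε →
          (ε ≤ 2 →
            (MultiSource.numSources c₁ (MultiSource.flattened q) ε : ℝ) ≤ C * √n / ε ^ 2) ∧
          ∀ p : Fin (MultiSource.numSources c₁ (MultiSource.flattened q) ε) → PMF (Fin n),
            (MultiSource.drawSamples p).map MultiSource.numSamples =
              MultiSource.poisson (MultiSource.numSources c₁ (MultiSource.flattened q) ε) ∧
            ((∀ i, p i = q) →
              2 / 3 ≤
                MultiSource.flattenedIdentityTester c₁ q ε p MultiSource.Verdict.accept) ∧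
            (MultiSource.Structural p q → (∀ i, ε ≤ MultiSource.l1Dist (p i) q) →
              2 / 3 ≤
                MultiSource.flattenedIdentityTester c₁ q ε p MultiSource.Verdict.reject) := by
  refine ⟨1000, by norm_num, fun n q ε hε p => ⟨MultiSource.identityTester_accept q hε p,
    MultiSource.identityTester_reject q hε p⟩, 2 * 1000 + 4, by norm_num,
    fun n q ε hε => ⟨fun hε2 => ?_, fun p =>
      ⟨MultiSource.map_numSamples_drawSamples p, fun hp => ?_, fun hstr hfar => ?_⟩⟩⟩
  · simpa using MultiSource.numSources_flattened_le (c := 1000) (by norm_num) q hε hε2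
  · rw [MultiSource.flattenedIdentityTester_eq]
    refine MultiSource.identityTester_accept _ hε _ fun i => ?_
    rw [hp i]
    rfl
  · rw [MultiSource.flattenedIdentityTester_eq]
    refine MultiSource.identityTester_reject _ hε _ hstr.flatten fun i => ?_
    exact (hfar i).trans_eq (MultiSource.l1Dist_flatten q (p i) q).symm
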